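/- Let $\Gamma=(V,E)$ be a finite simple graph. Orient each edge $e\in E$ arbitrarily, identify it with $[0,1]$, and let $\mathrm{init}(e),\mathrm{term}(e)\in V$ be the vertices at $x=0$ and $x=1$. For $u=(u_e)_{e\in E}\in C^2([0,1];\mathbb C)^E$ consider the boundary vectors $(u(0),u(1))$ and $(-u'(0),u'(1))$ in $\mathbb C^E\times\mathbb C^E$ (with its standard inner product), and put $$Y_\Gamma=\big\{\big((\varphi(\mathrm{init}(e)))_{e\in E},(\varphi(\mathrm{term}(e)))_{e\in E}\big) : \varphi\in\mathbb C^V\big\}\subset\mathbb C^E\times\mathbb C^E .$$ Let $\Delta^{CK}$ (continuity of the values, Kirchhoff condition for the outer normal derivatives) be the operator $u\mapsto(u_e'')_{e\in E}$ in $C([0,1];\mathbb C)^E$ whose domain consists of all $u\in C^2([0,1];\mathbb C)^E$ with $$(u(0),u(1))\in Y_\Gamma,\qquad (-u'(0),u'(1))\in Y_\Gamma^\perp,$$ and let $\Delta^{KC}$ (Kirchhoff condition for the values, continuity of the outer normal derivatives) be the same operator with $Y_\Gamma$ and $Y_\Gamma^\perp$ interchanged. Two graphs are called isospectral with respect to $-\Delta^{CK}$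 (respectively $-\Delta^{KC}$) if the corresponding operators have the same eigenvalues, each with the same multiplicity (dimension of the eigenspace). Let $\Gamma_1$ and $\Gamma_2$ be finite simple graphs, with arbitrary orientations of their edges. Then $\Gamma_1$ and $\Gamma_2$ are isospectral with respect to $-\Delta^{CK}$ if and only if they are isospectral with respect to $-\Delta^{KC}$. -/

import Mathlib

noncomputable section

namespace MetricGraph

/-! ### The second derivative on finitely many copies of `[0,1]` -/

/-- The space `C[0,1]` of continuous complex-valued functions on the closed unit interval. -/
abbrev C01 : Type := C(Set.Icc (0 : ℝ) 1, ℂ)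

/-- The extension of a function on `[0,1]` to `ℝ` by its boundary values. It is only ever
differentiated within `[0,1]`, so the values outside play no role. -/
def ext (f : C01) : ℝ → ℂ := Set.IccExtend (zero_le_one' ℝ) f

/-- `f ∈ C²[0,1]` (with one-sided derivatives at the end points). -/
def IsC2 (f : C01) : Prop := ContDiffOn ℝ 2 (ext f) (Set.Icc 0 1)

/-- The first derivative of a function on `[0,1]` (one-sided at the end points). -/
def d1 (f : C01) (x : ℝ) : ℂ := derivWithin (ext f) (Set.Icc 0 1) x

/-- The second derivative of a function on `[0,1]` (one-sided at the end points). -/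
def d2 (f : C01) (x : ℝ) : ℂ := iteratedDerivWithin 2 (ext f) (Set.Icc 0 1) x

theorem ext_add (f g : C01) : ext (f + g) = ext f + ext g := rfl

theorem ext_smul (c : ℂ) (f : C01) : ext (c • f) = c • ext f := rfl

theorem isC2_zero : IsC2 0 := contDiffOn_const (c := (0 : ℂ))

theorem IsC2.add {f g : C01} (hf : IsC2 f) (hg : IsC2 g) : IsC2 (f + g) :=
  ContDiffOn.add hf hg

theorem IsC2.smul {f : C01} (c : ℂ) (hf : IsC2 f) : IsC2 (c • f) :=
  ContDiffOn.const_smul c hf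

theorem IsC2.differentiableWithinAt {f : C01} (hf : IsC2 f) {x : ℝ} (hx : x ∈ Set.Icc (0 : ℝ) 1) :
    DifferentiableWithinAt ℝ (ext f) (Set.Icc 0 1) x :=
  (ContDiffOn.differentiableOn hf (by norm_num)) x hx

theorem d1_zero (x : ℝ) : d1 0 x = 0 := by
  have h : ext 0 = fun _ => (0 : ℂ) := rfl
  simp [d1, h]

theorem d1_add {f g : C01} (hf : IsC2 f) (hg : IsC2 g) {x : ℝ} (hx : x ∈ Set.Icc (0 : ℝ) 1) :
    d1 (f + g) x = d1 f x + d1 g x := by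
  rw [d1, ext_add]
  exact derivWithin_add (hf.differentiableWithinAt hx) (hg.differentiableWithinAt hx)

theorem d1_smul {f : C01} (hf : IsC2 f) (c : ℂ) {x : ℝ} (hx : x ∈ Set.Icc (0 : ℝ) 1) :
    d1 (c • f) x = c * d1 f x := by
  rw [d1, ext_smul]
  exact derivWithin_const_smul c (hf.differentiableWithinAt hx)

theorem d2_add {f g : C01} (hf : IsC2 f) (hg : IsC2 g) {x : ℝ} (hx : x ∈ Set.Icc (0 : ℝ) 1) :
    d2 (f + g) x = d2 f x + d2 g x := by
  rw [d2, ext_add]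
  exact iteratedDerivWithin_add hx (uniqueDiffOn_Icc zero_lt_one) (hf x hx) (hg x hx)

theorem d2_smul {f : C01} (hf : IsC2 f) (c : ℂ) {x : ℝ} (hx : x ∈ Set.Icc (0 : ℝ) 1) :
    d2 (c • f) x = c * d2 f x := by
  rw [d2, ext_smul]
  exact iteratedDerivWithin_const_smul hx (uniqueDiffOn_Icc zero_lt_one) c (hf x hx)

theorem IsC2.continuous_d2 {f : C01} (hf : IsC2 f) :
    Continuous fun x : Set.Icc (0 : ℝ) 1 => d2 f x :=
  (ContDiffOn.continuousOn_iteratedDerivWithin hf le_rfl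
    (uniqueDiffOn_Icc zero_lt_one)).domRestrict

variable {E : Type*}

/-- The boundary values `(u(0), u(1)) ∈ ℂ^E × ℂ^E` of `u : [0,1] → ℂ^E`. -/
def bdryValue (u : E → C01) : EuclideanSpace ℂ (E ⊕ E) :=
  WithLp.toLp 2 (Sum.elim (fun e => u e 0) (fun e => u e 1))

/-- The outer normal derivatives `(-u'(0), u'(1)) ∈ ℂ^E × ℂ^E` of `u : [0,1] → ℂ^E`. -/
def bdryNormalDeriv (u : E → C01) : EuclideanSpace ℂ (E ⊕ E) :=
  WithLp.toLp 2 (Sum.elim (fun e => -d1 (u e) 0) (fun e => d1 (u e) 1))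

variable [Fintype E]

/-- The functions `u ∈ C²[0,1]^E` with `(u(0), u(1)) ∈ Y` and `(-u'(0), u'(1)) ∈ Y^⊥`. -/
def laplacianDomain (Y : Submodule ℂ (EuclideanSpace ℂ (E ⊕ E))) : Submodule ℂ (E → C01) where
  carrier := {u | (∀ e, IsC2 (u e)) ∧ bdryValue u ∈ Y ∧ bdryNormalDeriv u ∈ Yᗮ}
  zero_mem' := by
    refine ⟨fun _ => isC2_zero, ?_, ?_⟩
    · convert Y.zero_mem using 1
      ext i; rcases i with i | i <;> simp [bdryValue]
    · convert Yᗮ.zero_mem using 1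
      ext i; rcases i with i | i <;> simp [bdryNormalDeriv, d1_zero]
  add_mem' := by
    rintro u v ⟨hu, hu0, hu1⟩ ⟨hv, hv0, hv1⟩
    refine ⟨fun e => (hu e).add (hv e), ?_, ?_⟩
    · convert Y.add_mem hu0 hv0 using 1
      ext i; rcases i with i | i <;> simp [bdryValue]
    · convert Yᗮ.add_mem hu1 hv1 using 1
      ext i; rcases i with i | i <;>
        simp [bdryNormalDeriv, d1_add (hu i) (hv i), add_comm]
  smul_mem' := by
    rintro c u ⟨hu, hu0, hu1⟩
    refine ⟨fun e => (hu e).smul c, ?_, ?_⟩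
    · convert Y.smul_mem c hu0 using 1
      ext i; rcases i with i | i <;> simp [bdryValue]
    · convert Yᗮ.smul_mem c hu1 using 1
      ext i; rcases i with i | i <;> simp [bdryNormalDeriv, d1_smul (hu i) c]

/-- The second derivative `Δ_Y u = (u_e'')_e` as an operator in `C[0,1]^E`, with domain the
`u ∈ C²[0,1]^E` such that `(u(0), u(1)) ∈ Y` and `(-u'(0), u'(1)) ∈ Y^⊥`. -/
def laplacian (Y : Submodule ℂ (EuclideanSpace ℂ (E ⊕ E))) : (E → C01) →ₗ.[ℂ] (E → C01) where
  domain := laplacianDomain Y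
  toFun :=
    { toFun := fun u e => ⟨fun x => d2 (u.1 e) x, (u.2.1 e).continuous_d2⟩
      map_add' := by
        intro u v
        ext e x
        exact d2_add (u.2.1 e) (v.2.1 e) x.2
      map_smul' := by
        intro c u
        ext e x
        exact d2_smul (u.2.1 e) c x.2 }

/-! ### Eigenvalues, multiplicities, isospectrality -/

/-- The space of solutions `u ∈ D(T)` of `T u = μ u`. -/
def eigenspace {F : Type*} [AddCommGroup F] [Module ℂ F] (T : F →ₗ.[ℂ] F) (μ : ℂ) :
    Submodule ℂ F where
  carrier := {u | ∃ h : u ∈ T.domain, T ⟨u, h⟩ = μ • u}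
  zero_mem' := ⟨T.domain.zero_mem, by
    have h : T ⟨0, T.domain.zero_mem⟩ = 0 := T.map_zero
    rw [h, smul_zero]⟩
  add_mem' := by
    rintro u v ⟨hu, hu'⟩ ⟨hv, hv'⟩
    refine ⟨T.domain.add_mem hu hv, ?_⟩
    have h := T.map_add ⟨u, hu⟩ ⟨v, hv⟩
    rw [hu', hv', ← smul_add] at h
    exact h
  smul_mem' := by
    rintro c u ⟨hu, hu'⟩
    refine ⟨T.domain.smul_mem c hu, ?_⟩
    have h := T.map_smul c ⟨u, hu⟩
    rw [hu', smul_comm] at h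
    exact h

/-- The multiplicity of `μ` as an eigenvalue of `T`, i.e. the dimension of its eigenspace
(it is `0` if and only if `μ` is not an eigenvalue). -/
def eigenMultiplicity {F : Type*} [AddCommGroup F] [Module ℂ F] (T : F →ₗ.[ℂ] F) (μ : ℂ) : ℕ∞ :=
  (Module.rank ℂ (eigenspace T μ)).toENat

/-- Two operators are isospectral if they have the same eigenvalues with the same
multiplicities. -/
def Isospectral {F₁ F₂ : Type*} [AddCommGroup F₁] [Module ℂ F₁] [AddCommGroup F₂] [Module ℂ F₂]
    (T₁ : F₁ →ₗ.[ℂ] F₁) (T₂ : F₂ →ₗ.[ℂ] F₂) : Prop :=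
  ∀ μ : ℂ, eigenMultiplicity T₁ μ = eigenMultiplicity T₂ μ

/-! ### The metric graph of a simple graph, and the two vertex conditions -/

variable {V : Type*}

/-- A parametrization of the edges of `G` by `[0,1]`: the edge `e` runs from `init e`
(at `x = 0`) to `term e` (at `x = 1`). -/
structure EdgeOrientation (G : SimpleGraph V) where
  init : G.edgeSet → V
  term : G.edgeSet → V
  ends_eq : ∀ e, s(init e, term e) = (e : Sym2 V)

variable [Fintype V] [DecidableEq V] {G : SimpleGraph V} [DecidableRel G.Adj]

/-- The signed incidence matrix `𝒟`: the entry at `(v, e)` is `1` if `e` ends at `v`, `-1` if `e`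
starts at `v`, and `0` otherwise. -/
def incidence (o : EdgeOrientation G) : Matrix V G.edgeSet ℝ :=
  fun v e => if o.term e = v then 1 else if o.init e = v then -1 else 0

/-- The matrix of `φ ↦ (φ(init e))_e, (φ(term e))_e`: the transposed negative part of the
incidence matrix on top of the transposed positive part. -/
def stackedIncidence (o : EdgeOrientation G) : Matrix (G.edgeSet ⊕ G.edgeSet) V ℂ :=
  Matrix.fromRows (Matrix.of fun e v => (((incidence o v e)⁻ : ℝ) : ℂ))
    (Matrix.of fun e v => (((incidence o v e)⁺ : ℝ) : ℂ))

/-- The range of the stacked incidence matrix: the boundary values of functions that are continuous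
at all vertices. -/
def vertexSpace (o : EdgeOrientation G) : Submodule ℂ (EuclideanSpace ℂ (G.edgeSet ⊕ G.edgeSet)) :=
  LinearMap.range (Matrix.toEuclideanLin (stackedIncidence o))

/-- `Δ^{CK}`: continuity of the values and Kirchhoff condition on the normal derivatives. -/
def laplacianCK (o : EdgeOrientation G) : (G.edgeSet → C01) →ₗ.[ℂ] (G.edgeSet → C01) :=
  laplacian (vertexSpace o)

/-- `Δ^{KC}`: Kirchhoff condition on the values and continuity of the normal derivatives. -/
def laplacianKC (o : EdgeOrientation G) : (G.edgeSet → C01) →ₗ.[ℂ] (G.edgeSet → C01) :=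
  laplacian (vertexSpace o)ᗮ

end MetricGraph

end

noncomputable section

namespace MetricGraph

/-! ### Solutions of `-u'' = μ u` on `[0,1]` -/

/-! The graph enters only through a subspace `Y` of the finite-dimensional boundary space, so it
suffices to pass isospectrality from `Y` to `Yᗮ` (`Isospectral.orthogonal`); as `Yᗮᗮ = Y`, the
converse is the same statement.

A solution of `-u'' = k² u` is fixed by its initial data `(a, b) = (u(0), u'(0))`, which turns an
eigenspace into a space of vectors cut out by two linear conditions (`eigenspace_eq_map`). For `k ≠
0`, exchanging values and derivatives up to scalars exchanges `Y` and `Yᗮ` and flips the sign of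
`cos k`, while `sin k` is kept. Hence the multiplicity of `k²` for `Yᗮ` is that of `(π - k)²` for
`Y`, with `2π` replacing `π - k` when `k = π` (`eigenMultiplicity_orthogonal`).

At `k = 0` this exchange breaks down. There the multiplicity is recovered from those of `0`, `π²`,
`4π²` for `Y` and dimension formulas relating `Y`, `Yᗮ`, the diagonal and the antidiagonal
(`finrank_comap_graphMap_orthogonal`). -/

theorem ext_apply (f : C01) {x : ℝ} (hx : x ∈ Set.Icc (0 : ℝ) 1) : ext f x = f ⟨x, hx⟩ :=
  Set.IccExtend_of_mem _ _ hx

theorem d2_eq (f : C01) : d2 f = derivWithin (d1 f) (Set.Icc 0 1) := by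
  funext x
  have h : iteratedDerivWithin 1 (ext f) (Set.Icc 0 1) = d1 f :=
    funext fun y => congrFun iteratedDerivWithin_one y
  rw [d2, iteratedDerivWithin_succ, h]

theorem IsC2.hasDerivWithinAt {f : C01} (hf : IsC2 f) {x : ℝ} (hx : x ∈ Set.Icc (0 : ℝ) 1) :
    HasDerivWithinAt (ext f) (d1 f x) (Set.Icc 0 1) x :=
  (hf.differentiableWithinAt hx).hasDerivWithinAt

theorem IsC2.hasDerivWithinAt_d1 {f : C01} (hf : IsC2 f) {x : ℝ} (hx : x ∈ Set.Icc (0 : ℝ) 1) :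
    HasDerivWithinAt (d1 f) (d2 f x) (Set.Icc 0 1) x := by
  rw [d2_eq]
  refine DifferentiableWithinAt.hasDerivWithinAt ?_
  exact (ContDiffOn.differentiableOn
    (ContDiffOn.derivWithin hf (uniqueDiffOn_Icc zero_lt_one) (m := 1) (by norm_num))
    (by norm_num)) x hx

/-- The restriction of a continuous function to `[0,1]`. -/
def restrict (g : ℝ → ℂ) (hg : Continuous g) : C01 := ⟨fun x => g x, by fun_prop⟩

theorem ext_restrict (g : ℝ → ℂ) (hg : Continuous g) :
    Set.EqOn (ext (restrict g hg)) g (Set.Icc 0 1) :=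
  fun _ hx => ext_apply _ hx

theorem isC2_restrict {g : ℝ → ℂ} (hg : ContDiff ℝ 2 g) : IsC2 (restrict g hg.continuous) :=
  hg.contDiffOn.congr (ext_restrict g hg.continuous)

theorem d1_restrict {g : ℝ → ℂ} (hg : Continuous g) {y : ℂ} {x : ℝ}
    (hx : x ∈ Set.Icc (0 : ℝ) 1) (h : HasDerivAt g y x) : d1 (restrict g hg) x = y :=
  (h.hasDerivWithinAt.congr (ext_restrict g hg) (ext_restrict g hg hx)).derivWithin
    (uniqueDiffOn_Icc zero_lt_one x hx)

/-- The solutions `c`, `s` of `-u'' = μ u` with `c(0) = 1`, `c'(0) = 0`, `s(0) = 0`, `s'(0) = 1`. -/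
structure IsFundamentalPair (μ : ℂ) (c s : C01) : Prop where
  isC2_cos : IsC2 c
  isC2_sin : IsC2 s
  d1_cos : ∀ x (hx : x ∈ Set.Icc (0 : ℝ) 1), d1 c x = -μ * s ⟨x, hx⟩
  d1_sin : ∀ x (hx : x ∈ Set.Icc (0 : ℝ) 1), d1 s x = c ⟨x, hx⟩
  cos_zero : c 0 = 1
  sin_zero : s 0 = 0
  sq_add_sq : ∀ x, c x ^ 2 + μ * s x ^ 2 = 1

namespace IsFundamentalPair

variable {μ : ℂ} {c s : C01}

theorem d2_cos (h : IsFundamentalPair μ c s) {x : ℝ} (hx : x ∈ Set.Icc (0 : ℝ) 1) :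
    d2 c x = -μ * c ⟨x, hx⟩ := by
  have h1 : Set.EqOn (d1 c) (ext (-μ • s)) (Set.Icc 0 1) := fun y hy => by
    rw [h.d1_cos y hy, ext_apply _ hy]; rfl
  rw [d2_eq, derivWithin_congr h1 (h1 hx), ← h.d1_sin x hx]
  exact d1_smul h.isC2_sin (-μ) hx

theorem d2_sin (h : IsFundamentalPair μ c s) {x : ℝ} (hx : x ∈ Set.Icc (0 : ℝ) 1) :
    d2 s x = -μ * s ⟨x, hx⟩ := by
  have h1 : Set.EqOn (d1 s) (ext c) (Set.Icc 0 1) := fun y hy => by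
    rw [h.d1_sin y hy, ext_apply _ hy]
  rw [d2_eq, derivWithin_congr h1 (h1 hx), ← h.d1_cos x hx]
  rfl

/-- Every solution of `-u'' = μ u` is the combination of the fundamental pair given by its initial
values. -/
theorem eq_smul_add_smul (h : IsFundamentalPair μ c s) {f : C01} (hf : IsC2 f)
    (hf2 : ∀ x (hx : x ∈ Set.Icc (0 : ℝ) 1), d2 f x = -μ * f ⟨x, hx⟩) :
    f = f 0 • c + d1 f 0 • s := by
  have hz : (0 : ℝ) ∈ Set.Icc (0 : ℝ) 1 := ⟨le_rfl, zero_le_one⟩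
  have hconst : ∀ g : ℝ → ℂ, (∀ x ∈ Set.Icc (0 : ℝ) 1, HasDerivWithinAt g 0 (Set.Icc 0 1) x) →
      ∀ x ∈ Set.Icc (0 : ℝ) 1, g x = g 0 := fun g hg =>
    constant_of_derivWithin_zero (fun x hx => (hg x hx).differentiableWithinAt)
      fun x hx => (hg x (Set.Ico_subset_Icc_self hx)).derivWithin
        (uniqueDiffOn_Icc zero_lt_one x (Set.Ico_subset_Icc_self hx))
  -- Undoing the flow: the inverse of the fundamental matrix, whose determinant is `c² + μ s² = 1`,
  -- applied to `(f, f')` gives two constants, `hp` and `hq`. Solving them for `f` is the closing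
  -- linear combination.
  have hp := hconst (fun x => ext f x * ext c x - d1 f x * ext s x) fun x hx => by
    refine (((hf.hasDerivWithinAt hx).mul (h.isC2_cos.hasDerivWithinAt hx)).sub
      ((hf.hasDerivWithinAt_d1 hx).mul (h.isC2_sin.hasDerivWithinAt hx))).congr_deriv ?_
    rw [h.d1_cos x hx, h.d1_sin x hx, hf2 x hx, ext_apply f hx, ext_apply c hx, ext_apply s hx]
    ring
  have hq := hconst (fun x => μ * (ext f x * ext s x) + d1 f x * ext c x) fun x hx => by
    refine ((((hf.hasDerivWithinAt hx).mul (h.isC2_sin.hasDerivWithinAt hx)).const_mul μ).add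
      ((hf.hasDerivWithinAt_d1 hx).mul (h.isC2_cos.hasDerivWithinAt hx))).congr_deriv ?_
    rw [h.d1_cos x hx, h.d1_sin x hx, hf2 x hx, ext_apply f hx, ext_apply c hx, ext_apply s hx]
    ring
  have hc0 : c ⟨0, hz⟩ = 1 := h.cos_zero
  have hs0 : s ⟨0, hz⟩ = 0 := h.sin_zero
  ext ⟨x, hx⟩
  have hpx := hp x hx
  have hqx := hq x hx
  simp only [ext_apply _ hx, ext_apply _ hz, hc0, hs0] at hpx hqx
  have hsq := h.sq_add_sq ⟨x, hx⟩
  change f ⟨x, hx⟩ = f ⟨0, hz⟩ * c ⟨x, hx⟩ + d1 f 0 * s ⟨x, hx⟩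
  linear_combination (-f ⟨x, hx⟩) * hsq + c ⟨x, hx⟩ * hpx + s ⟨x, hx⟩ * hqx

end IsFundamentalPair

/-! ### Explicit fundamental pairs: trigonometric for `μ ≠ 0`, affine for `μ = 0` -/

theorem exists_isFundamentalPair_sq {k : ℂ} (hk : k ≠ 0) :
    ∃ c s : C01, IsFundamentalPair (k ^ 2) c s ∧ c 1 = Complex.cos k ∧
      s 1 = Complex.sin k / k := by
  have hl : ∀ x : ℝ, HasDerivAt (fun y : ℝ => k * (y : ℂ)) k x := fun x => by
    simpa using (Complex.ofRealCLM.hasDerivAt (x := x)).const_mul k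
  have hcd : ContDiff ℝ 2 fun x : ℝ => k * (x : ℂ) :=
    contDiff_const.mul Complex.ofRealCLM.contDiff
  have hc : ContDiff ℝ 2 fun x : ℝ => Complex.cos (k * x) :=
    (Complex.contDiff_cos.restrict_scalars ℝ).comp hcd
  have hs : ContDiff ℝ 2 fun x : ℝ => Complex.sin (k * x) / k :=
    ((Complex.contDiff_sin.restrict_scalars ℝ).comp hcd).div_const k
  refine ⟨restrict _ hc.continuous, restrict _ hs.continuous,
    ⟨isC2_restrict hc, isC2_restrict hs, fun x hx => d1_restrict _ hx ?_,
      fun x hx => d1_restrict _ hx ?_, ?_, ?_, ?_⟩, ?_, ?_⟩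
  · refine ((Complex.hasDerivAt_cos (k * x)).comp x (hl x)).congr_deriv ?_
    change _ = -k ^ 2 * (Complex.sin (k * x) / k)
    field_simp
  · refine (((Complex.hasDerivAt_sin (k * x)).comp x (hl x)).div_const k).congr_deriv ?_
    change _ = Complex.cos (k * x)
    field_simp
  · simp [restrict]
  · simp [restrict]
  · intro x
    change Complex.cos (k * (x : ℝ)) ^ 2 + k ^ 2 * (Complex.sin (k * (x : ℝ)) / k) ^ 2 = 1
    rw [div_pow, mul_div_cancel₀ _ (pow_ne_zero 2 hk), add_comm, Complex.sin_sq_add_cos_sq]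
  · simp [restrict]
  · simp [restrict]

theorem exists_isFundamentalPair_zero :
    ∃ c s : C01, IsFundamentalPair 0 c s ∧ c 1 = 1 ∧ s 1 = 1 := by
  have hc : ContDiff ℝ 2 fun _ : ℝ => (1 : ℂ) := contDiff_const
  have hs : ContDiff ℝ 2 fun x : ℝ => (x : ℂ) := Complex.ofRealCLM.contDiff
  refine ⟨restrict _ hc.continuous, restrict _ hs.continuous,
    ⟨isC2_restrict hc, isC2_restrict hs, fun x hx => d1_restrict _ hx ?_,
      fun x hx => d1_restrict _ hx ?_, ?_, ?_, ?_⟩, ?_, ?_⟩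
  · simpa using hasDerivAt_const x (1 : ℂ)
  · exact Complex.ofRealCLM.hasDerivAt (x := x)
  all_goals simp [restrict]

/-! ### Eigenspaces in terms of initial values -/

section

variable {E : Type*}

/-- The vector `(p, q)` of `ℂ^E × ℂ^E`. -/
def bdryPair : ((E → ℂ) × (E → ℂ)) →ₗ[ℂ] EuclideanSpace ℂ (E ⊕ E) where
  toFun p := WithLp.toLp 2 (Sum.elim p.1 p.2)
  map_add' p q := by ext (i | i) <;> simp
  map_smul' r p := by ext (i | i) <;> simp

/-- The map `a ↦ (a, c a)`. -/
def graphMap (c : ℂ) : (E → ℂ) →ₗ[ℂ] EuclideanSpace ℂ (E ⊕ E) :=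
  bdryPair ∘ₗ LinearMap.id.prod (c • LinearMap.id)

theorem graphMap_injective (c : ℂ) : Function.Injective (graphMap (E := E) c) :=
  fun _ _ h => funext fun e => congrArg (fun v : EuclideanSpace ℂ (E ⊕ E) => v (Sum.inl e)) h

theorem finrank_comap_graphMap (Y : Submodule ℂ (EuclideanSpace ℂ (E ⊕ E))) (c : ℂ) :
    Module.finrank ℂ (Y.comap (graphMap c)) =
      Module.finrank ℂ (Y ⊓ LinearMap.range (graphMap c) : Submodule ℂ _) := by
  rw [inf_comm, ← Submodule.map_comap_eq]
  exact (Submodule.equivMapOfInjective _ (graphMap_injective c) _).finrank_eq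

/-- The initial values `(a, b) = (u(0), u'(0))` of those combinations `u` of a fundamental pair with
values `c`, `s` at `1` that satisfy the boundary conditions given by `Y`. -/
def initialValues [Fintype E] (Y : Submodule ℂ (EuclideanSpace ℂ (E ⊕ E))) (μ c s : ℂ) :
    Submodule ℂ ((E → ℂ) × (E → ℂ)) where
  carrier := {p | bdryPair (p.1, c • p.1 + s • p.2) ∈ Y ∧
    bdryPair (-p.2, c • p.2 - (μ * s) • p.1) ∈ Yᗮ}
  zero_mem' := by
    have h : bdryPair (((0 : E → ℂ), (0 : E → ℂ))) = 0 := map_zero _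
    constructor <;> simp [h]
  add_mem' := by
    rintro p q ⟨hp, hp'⟩ ⟨hq, hq'⟩
    refine ⟨?_, ?_⟩
    · convert Y.add_mem hp hq using 1
      rw [← map_add]
      congr 1
      ext e <;> simp; ring
    · convert Yᗮ.add_mem hp' hq' using 1
      rw [← map_add]
      congr 1
      ext e <;> simp <;> ring
  smul_mem' := by
    rintro r p ⟨hp, hp'⟩
    refine ⟨?_, ?_⟩
    · convert Y.smul_mem r hp using 1
      rw [← map_smul]
      congr 1
      ext e <;> simp; ring
    · convert Yᗮ.smul_mem r hp' using 1
      rw [← map_smul]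
      congr 1
      ext e <;> simp; ring

/-- The combination `u = a c + b s` of a pair of functions. -/
def combination (c s : C01) : ((E → ℂ) × (E → ℂ)) →ₗ[ℂ] (E → C01) where
  toFun p e := p.1 e • c + p.2 e • s
  map_add' p q := by ext e x; simp; ring
  map_smul' r p := by ext e x; simp; ring

namespace IsFundamentalPair

variable {μ : ℂ} {c s : C01}

theorem isC2_combination (h : IsFundamentalPair μ c s) (p : (E → ℂ) × (E → ℂ)) (e : E) :
    IsC2 (combination c s p e) :=
  (h.isC2_cos.smul _).add (h.isC2_sin.smul _)

theorem d1_combination (h : IsFundamentalPair μ c s) (p : (E → ℂ) × (E → ℂ)) (e : E) {x : ℝ}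
    (hx : x ∈ Set.Icc (0 : ℝ) 1) :
    d1 (combination c s p e) x = p.2 e * c ⟨x, hx⟩ - μ * p.1 e * s ⟨x, hx⟩ := by
  change d1 (p.1 e • c + p.2 e • s) x = _
  rw [d1_add (h.isC2_cos.smul _) (h.isC2_sin.smul _) hx, d1_smul h.isC2_cos _ hx,
    d1_smul h.isC2_sin _ hx, h.d1_cos x hx, h.d1_sin x hx]
  ring

theorem d2_combination (h : IsFundamentalPair μ c s) (p : (E → ℂ) × (E → ℂ)) (e : E) {x : ℝ}
    (hx : x ∈ Set.Icc (0 : ℝ) 1) :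
    d2 (combination c s p e) x = -μ * combination c s p e ⟨x, hx⟩ := by
  change d2 (p.1 e • c + p.2 e • s) x = -μ * (p.1 e * c ⟨x, hx⟩ + p.2 e * s ⟨x, hx⟩)
  rw [d2_add (h.isC2_cos.smul _) (h.isC2_sin.smul _) hx, d2_smul h.isC2_cos _ hx,
    d2_smul h.isC2_sin _ hx, h.d2_cos hx, h.d2_sin hx]
  ring

theorem combination_injective (h : IsFundamentalPair μ c s) :
    Function.Injective (combination (E := E) c s) := by
  refine (injective_iff_map_eq_zero _).2 fun p hp => ?_
  have hz : (0 : ℝ) ∈ Set.Icc (0 : ℝ) 1 := ⟨le_rfl, zero_le_one⟩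
  have hc0 : c ⟨0, hz⟩ = 1 := h.cos_zero
  have hs0 : s ⟨0, hz⟩ = 0 := h.sin_zero
  ext e
  · have h1 : combination c s p e 0 = 0 := by rw [hp]; rfl
    change p.1 e * c 0 + p.2 e * s 0 = 0 at h1
    simpa [h.cos_zero, h.sin_zero] using h1
  · have h1 := h.d1_combination p e hz
    rw [hp, hc0, hs0] at h1
    have h2 : d1 ((0 : E → C01) e) 0 = 0 := d1_zero 0
    rw [h2] at h1
    simpa using h1.symm

theorem bdryValue_combination (h : IsFundamentalPair μ c s) (p : (E → ℂ) × (E → ℂ)) :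
    bdryValue (combination c s p) = bdryPair (p.1, c 1 • p.1 + s 1 • p.2) := by
  ext (e | e)
  · change p.1 e * c 0 + p.2 e * s 0 = p.1 e
    simp [h.cos_zero, h.sin_zero]
  · change p.1 e * c 1 + p.2 e * s 1 = c 1 * p.1 e + s 1 * p.2 e
    ring

theorem bdryNormalDeriv_combination (h : IsFundamentalPair μ c s) (p : (E → ℂ) × (E → ℂ)) :
    bdryNormalDeriv (combination c s p) =
      bdryPair (-p.2, c 1 • p.2 - (μ * s 1) • p.1) := by
  have hz : (0 : ℝ) ∈ Set.Icc (0 : ℝ) 1 := ⟨le_rfl, zero_le_one⟩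
  have ho : (1 : ℝ) ∈ Set.Icc (0 : ℝ) 1 := ⟨zero_le_one, le_rfl⟩
  have hc0 : c ⟨0, hz⟩ = 1 := h.cos_zero
  have hs0 : s ⟨0, hz⟩ = 0 := h.sin_zero
  ext (e | e)
  · change -d1 (combination c s p e) 0 = -p.2 e
    rw [h.d1_combination p e hz, hc0, hs0]
    ring
  · change d1 (combination c s p e) 1 = c ⟨1, ho⟩ * p.2 e - μ * s ⟨1, ho⟩ * p.1 e
    rw [h.d1_combination p e ho]
    ring

variable [Fintype E]

theorem eigenspace_eq_map (h : IsFundamentalPair μ c s)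
    (Y : Submodule ℂ (EuclideanSpace ℂ (E ⊕ E))) :
    eigenspace (-laplacian Y) μ = (initialValues Y μ (c 1) (s 1)).map (combination c s) := by
  ext u
  constructor
  · rintro ⟨hu, hu'⟩
    have hd2 : ∀ e x (hx : x ∈ Set.Icc (0 : ℝ) 1), d2 (u e) x = -μ * u e ⟨x, hx⟩ := by
      intro e x hx
      have h1 : -d2 (u e) x = μ * u e ⟨x, hx⟩ :=
        DFunLike.congr_fun (congrFun hu' e) (⟨x, hx⟩ : Set.Icc (0 : ℝ) 1)
      linear_combination -h1
    have hu2 : (∀ e, IsC2 (u e)) ∧ bdryValue u ∈ Y ∧ bdryNormalDeriv u ∈ Yᗮ := hu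
    obtain ⟨hC, hY, hY'⟩ := hu2
    have hcomb : combination c s (fun e => u e 0, fun e => d1 (u e) 0) = u :=
      funext fun e => (h.eq_smul_add_smul (hC e) (hd2 e)).symm
    refine ⟨_, ⟨?_, ?_⟩, hcomb⟩
    · rwa [← h.bdryValue_combination, hcomb]
    · rwa [← h.bdryNormalDeriv_combination, hcomb]
  · rintro ⟨p, ⟨hp, hp'⟩, rfl⟩
    refine ⟨⟨h.isC2_combination p, ?_, ?_⟩, ?_⟩
    · rwa [h.bdryValue_combination]
    · rwa [h.bdryNormalDeriv_combination]
    · ext e ⟨x, hx⟩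
      change -d2 (combination c s p e) x = μ * combination c s p e ⟨x, hx⟩
      rw [h.d2_combination p e hx]
      ring

/-- Initial data live in a finite-dimensional space, so every multiplicity is a natural number and
can be handled by `finrank` arithmetic. -/
theorem eigenMultiplicity_eq (h : IsFundamentalPair μ c s)
    (Y : Submodule ℂ (EuclideanSpace ℂ (E ⊕ E))) :
    eigenMultiplicity (-laplacian Y) μ =
      (Module.finrank ℂ (initialValues Y μ (c 1) (s 1)) : ℕ∞) := by
  rw [eigenMultiplicity, h.eigenspace_eq_map Y,
    ← (Submodule.equivMapOfInjective _ h.combination_injective _).rank_eq,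
    ← Module.finrank_eq_rank, Cardinal.toENat_nat]

end IsFundamentalPair

variable [Fintype E]

/-! ### Interchanging `Y` and `Yᗮ` -/

theorem mem_initialValues {Y : Submodule ℂ (EuclideanSpace ℂ (E ⊕ E))} {μ c s : ℂ}
    {p : (E → ℂ) × (E → ℂ)} :
    p ∈ initialValues Y μ c s ↔ bdryPair (p.1, c • p.1 + s • p.2) ∈ Y ∧
      bdryPair (-p.2, c • p.2 - (μ * s) • p.1) ∈ Yᗮ :=
  Iff.rfl

/-- The map `(a, b) ↦ (-b, -r a)`. -/
def swapNeg {r : ℂ} (hr : r ≠ 0) : ((E → ℂ) × (E → ℂ)) ≃ₗ[ℂ] ((E → ℂ) × (E → ℂ)) where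
  toFun p := (-p.2, -(r • p.1))
  invFun p := (-(r⁻¹ • p.2), -p.1)
  map_add' p q := by ext e <;> simp <;> ring
  map_smul' t p := by ext e <;> simp; ring
  left_inv p := by ext e <;> simp [hr]
  right_inv p := by ext e <;> simp [hr]

/-- Under `swapNeg` the value condition for `Y` becomes the derivative condition for `Yᗮ`, and the
derivative condition for `Y` becomes `r` times the value condition for `Yᗮ`. The hypotheses on `r`
are exactly what makes the coefficients match. -/
theorem finrank_initialValues_orthogonal (Y : Submodule ℂ (EuclideanSpace ℂ (E ⊕ E)))
    {μ μ' c s s' r : ℂ} (hr : r ≠ 0) (h : r * s' = μ * s) (h' : μ' * s' = r * s) :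
    Module.finrank ℂ (initialValues Yᗮ μ c s) =
      Module.finrank ℂ (initialValues Y μ' (-c) s') := by
  have heq : initialValues Yᗮ μ c s =
      (initialValues Y μ' (-c) s').comap (swapNeg hr).toLinearMap := by
    ext p
    have h1 : (swapNeg hr p).1 = -p.2 := rfl
    have h2 : (swapNeg hr p).2 = -(r • p.1) := rfl
    rw [Submodule.mem_comap, LinearEquiv.coe_coe, mem_initialValues, mem_initialValues,
      Submodule.orthogonal_orthogonal, h1, h2, and_comm]
    have e1 : -c • -p.2 + s' • -(r • p.1) = c • p.2 - (μ * s) • p.1 := by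
      ext e
      simp only [Pi.add_apply, Pi.sub_apply, Pi.smul_apply, Pi.neg_apply, smul_eq_mul]
      linear_combination (-p.1 e) * h
    have e2 : ((-(-(r • p.1)), -c • -(r • p.1) - (μ' * s') • -p.2) : (E → ℂ) × (E → ℂ)) =
        r • (p.1, c • p.1 + s • p.2) := by
      ext e
      · simp
      · simp only [Pi.add_apply, Pi.sub_apply, Pi.smul_apply, Pi.neg_apply, smul_eq_mul,
          Prod.smul_mk]
        linear_combination p.2 e * h'
    rw [e1, e2, map_smul, Submodule.smul_mem_iff _ hr]
  rw [heq]
  exact LinearEquiv.finrank_eq (LinearEquiv.ofSubmodule' (swapNeg hr) _)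

theorem eigenMultiplicity_orthogonal (Y : Submodule ℂ (EuclideanSpace ℂ (E ⊕ E))) {k k' : ℂ}
    (hk : k ≠ 0) (hk' : k' ≠ 0) (hcos : Complex.cos k' = -Complex.cos k)
    (hsin : Complex.sin k' = Complex.sin k) :
    eigenMultiplicity (-laplacian Yᗮ) (k ^ 2) = eigenMultiplicity (-laplacian Y) (k' ^ 2) := by
  obtain ⟨c, s, h, hc, hs⟩ := exists_isFundamentalPair_sq hk
  obtain ⟨c', s', h', hc', hs'⟩ := exists_isFundamentalPair_sq hk'
  rw [h.eigenMultiplicity_eq, h'.eigenMultiplicity_eq, hc, hs, hc', hs', hcos, hsin,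
    -- The scaling is `r = k k'`: with `s = sin k / k` and `s' = sin k' / k'`, both compatibility
    -- conditions reduce to `sin k' = sin k`.
    finrank_initialValues_orthogonal Y (mul_ne_zero hk hk')]
  · field_simp
  · field_simp

/-! ### The eigenvalue zero -/

theorem inner_bdryPair (p q : (E → ℂ) × (E → ℂ)) :
    inner ℂ (bdryPair p) (bdryPair q) =
      ∑ e, q.1 e * starRingEnd ℂ (p.1 e) + ∑ e, q.2 e * starRingEnd ℂ (p.2 e) := by
  rw [PiLp.inner_apply, Fintype.sum_sum_type]
  rfl

theorem finrank_range_graphMap (c : ℂ) :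
    Module.finrank ℂ (LinearMap.range (graphMap (E := E) c)) = Fintype.card E := by
  rw [LinearMap.finrank_range_of_inj (graphMap_injective c), Module.finrank_fintype_fun_eq_card]

/-- The hypothesis makes the two graphs orthogonal, and each has half the dimension of the ambient
space. -/
theorem orthogonal_range_graphMap {c c' : ℂ} (h : 1 + starRingEnd ℂ c * c' = 0) :
    (LinearMap.range (graphMap (E := E) c))ᗮ = LinearMap.range (graphMap c') := by
  symm
  refine Submodule.eq_of_le_of_finrank_eq ?_ ?_
  · rintro _ ⟨b, rfl⟩
    rw [Submodule.mem_orthogonal]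
    rintro _ ⟨a, rfl⟩
    refine (inner_bdryPair _ _).trans ?_
    rw [← Finset.sum_add_distrib]
    refine Finset.sum_eq_zero fun e _ => ?_
    change b e * starRingEnd ℂ (a e) + c' * b e * starRingEnd ℂ (c * a e) = 0
    rw [map_mul]
    linear_combination b e * starRingEnd ℂ (a e) * h
  · have h1 := Submodule.finrank_add_finrank_orthogonal (LinearMap.range (graphMap (E := E) c))
    rw [finrank_euclideanSpace, Fintype.card_sum, finrank_range_graphMap] at h1
    rw [finrank_range_graphMap]
    omega

/-- The complement of `Y` plus the graph of `c` is `Yᗮ` intersected with the graph of `c'`; combine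
this with the dimension formula for sum and intersection. -/
theorem finrank_comap_graphMap_orthogonal (Y : Submodule ℂ (EuclideanSpace ℂ (E ⊕ E)))
    {c c' : ℂ} (h : 1 + starRingEnd ℂ c * c' = 0) :
    Module.finrank ℂ (Yᗮ.comap (graphMap c')) + Module.finrank ℂ Y =
      Fintype.card E + Module.finrank ℂ (Y.comap (graphMap c)) := by
  have h1 := Submodule.finrank_add_finrank_orthogonal (Y ⊔ LinearMap.range (graphMap (E := E) c))
  have h2 := Submodule.finrank_sup_add_finrank_inf_eq Y (LinearMap.range (graphMap (E := E) c))
  rw [← Submodule.inf_orthogonal, orthogonal_range_graphMap h, ← finrank_comap_graphMap,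
    finrank_euclideanSpace, Fintype.card_sum] at h1
  rw [← finrank_comap_graphMap, finrank_range_graphMap] at h2
  omega

theorem finrank_prod_submodule {M N : Type*} [AddCommGroup M] [Module ℂ M]
    [AddCommGroup N] [Module ℂ N] [FiniteDimensional ℂ M] [FiniteDimensional ℂ N]
    (p : Submodule ℂ M) (q : Submodule ℂ N) :
    Module.finrank ℂ (p.prod q) = Module.finrank ℂ p + Module.finrank ℂ q := by
  rw [← Module.finrank_prod]
  exact LinearEquiv.finrank_eq
    { toFun := fun x => (⟨x.1.1, x.2.1⟩, ⟨x.1.2, x.2.2⟩)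
      invFun := fun x => ⟨(x.1, x.2), x.1.2, x.2.2⟩
      map_add' := fun _ _ => rfl
      map_smul' := fun _ _ => rfl }

/-- When the sine term vanishes, the conditions on `u(0)` and `u'(0)` decouple. -/
theorem finrank_initialValues_sin_zero (Y : Submodule ℂ (EuclideanSpace ℂ (E ⊕ E))) (μ c : ℂ) :
    Module.finrank ℂ (initialValues Y μ c 0) =
      Module.finrank ℂ (Y.comap (graphMap c)) + Module.finrank ℂ (Yᗮ.comap (graphMap (-c))) := by
  rw [← finrank_prod_submodule]
  suffices initialValues Y μ c 0 =
      (Y.comap (graphMap c)).prod (Yᗮ.comap (graphMap (-c))) by rw [this]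
  ext p
  have h1 : bdryPair (-p.2, c • p.2) = -graphMap (-c) p.2 := by
    change _ = -bdryPair (p.2, -c • p.2)
    rw [← map_neg]
    simp
  simp only [mem_initialValues, Submodule.mem_prod, Submodule.mem_comap, mul_zero, zero_smul,
    add_zero, sub_zero, h1, Submodule.neg_mem_iff]
  rfl

theorem finrank_initialValues_zero (Y : Submodule ℂ (EuclideanSpace ℂ (E ⊕ E))) :
    Module.finrank ℂ (initialValues Y 0 1 1) = Module.finrank ℂ (Y.comap (graphMap 1)) := by
  have : initialValues Y 0 1 1 = (Y.comap (graphMap 1)).prod ⊥ := by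
    ext p
    simp only [mem_initialValues, Submodule.mem_prod, Submodule.mem_comap, Submodule.mem_bot,
      one_smul, zero_mul, zero_smul, sub_zero]
    have hg : graphMap 1 p.1 = bdryPair (p.1, p.1) := by simp [graphMap]
    rw [hg]
    constructor
    · rintro ⟨h1, h2⟩
      -- Green's identity for affine `u`: pairing boundary values with normal derivatives leaves `∑
      -- |u_e'|² = 0`, so `u` is constant on each edge.
      have h3 := Submodule.inner_right_of_mem_orthogonal h1 h2
      rw [inner_bdryPair, ← Finset.sum_add_distrib] at h3
      have h4 : ∑ e, Complex.normSq (p.2 e) = 0 := by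
        have h5 : ((∑ e, Complex.normSq (p.2 e) : ℝ) : ℂ) = 0 := by
          rw [← h3, Complex.ofReal_sum]
          refine Finset.sum_congr rfl fun e _ => ?_
          simp only [Pi.neg_apply, Pi.add_apply, map_add, Complex.normSq_eq_conj_mul_self]
          ring
        exact_mod_cast h5
      have h6 : p.2 = 0 := funext fun e => Complex.normSq_eq_zero.1
        ((Finset.sum_eq_zero_iff_of_nonneg fun e _ => Complex.normSq_nonneg _).1 h4 e
          (Finset.mem_univ e))
      rw [h6, add_zero] at h1
      exact ⟨h1, h6⟩
    · rintro ⟨h1, h2⟩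
      rw [h2, add_zero]
      refine ⟨h1, ?_⟩
      have : bdryPair ((-0 : E → ℂ), (0 : E → ℂ)) = 0 := by rw [neg_zero]; exact map_zero _
      rw [this]
      exact Submodule.zero_mem _
  rw [this, finrank_prod_submodule, finrank_bot, add_zero]

theorem eigenMultiplicity_zero (Y : Submodule ℂ (EuclideanSpace ℂ (E ⊕ E))) :
    eigenMultiplicity (-laplacian Y) 0 = (Module.finrank ℂ (Y.comap (graphMap 1)) : ℕ∞) := by
  obtain ⟨c, s, h, hc, hs⟩ := exists_isFundamentalPair_zero
  rw [h.eigenMultiplicity_eq, hc, hs, finrank_initialValues_zero]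

theorem eigenMultiplicity_sq_of_sin_eq_zero (Y : Submodule ℂ (EuclideanSpace ℂ (E ⊕ E))) {k : ℂ}
    (hk : k ≠ 0) (hsin : Complex.sin k = 0) :
    eigenMultiplicity (-laplacian Y) (k ^ 2) =
      ((Module.finrank ℂ (Y.comap (graphMap (Complex.cos k))) +
        Module.finrank ℂ (Yᗮ.comap (graphMap (-Complex.cos k))) : ℕ) : ℕ∞) := by
  obtain ⟨c, s, h, hc, hs⟩ := exists_isFundamentalPair_sq hk
  rw [h.eigenMultiplicity_eq, hc, hs, hsin, zero_div, finrank_initialValues_sin_zero]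

end

theorem Isospectral.orthogonal {E₁ E₂ : Type*} [Fintype E₁] [Fintype E₂]
    {Y₁ : Submodule ℂ (EuclideanSpace ℂ (E₁ ⊕ E₁))}
    {Y₂ : Submodule ℂ (EuclideanSpace ℂ (E₂ ⊕ E₂))}
    (h : Isospectral (-laplacian Y₁) (-laplacian Y₂)) :
    Isospectral (-laplacian Y₁ᗮ) (-laplacian Y₂ᗮ) := by
  have hpi : (Real.pi : ℂ) ≠ 0 := Complex.ofReal_ne_zero.2 Real.pi_ne_zero
  intro μ
  obtain ⟨k, rfl⟩ : ∃ k : ℂ, k ^ 2 = μ := IsAlgClosed.exists_pow_nat_eq μ two_pos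
  by_cases hk : k = 0
  · have h0 := h 0
    -- At `π` and `2π` the sine vanishes and the cosine is `-1` and `1`, so these multiplicities
    -- involve only intersections with the diagonal and antidiagonal.
    have h1 := h ((Real.pi : ℂ) ^ 2)
    have h2 := h ((2 * Real.pi : ℂ) ^ 2)
    rw [eigenMultiplicity_zero, eigenMultiplicity_zero, Nat.cast_inj] at h0
    rw [eigenMultiplicity_sq_of_sin_eq_zero _ hpi Complex.sin_pi,
      eigenMultiplicity_sq_of_sin_eq_zero _ hpi Complex.sin_pi, Complex.cos_pi, neg_neg,
      Nat.cast_inj] at h1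
    rw [eigenMultiplicity_sq_of_sin_eq_zero _ (mul_ne_zero two_ne_zero hpi) Complex.sin_two_pi,
      eigenMultiplicity_sq_of_sin_eq_zero _ (mul_ne_zero two_ne_zero hpi) Complex.sin_two_pi,
      Complex.cos_two_pi, Nat.cast_inj] at h2
    have a1 := finrank_comap_graphMap_orthogonal Y₁ (c := 1) (c' := -1) (by simp)
    have a2 := finrank_comap_graphMap_orthogonal Y₂ (c := 1) (c' := -1) (by simp)
    have b1 := finrank_comap_graphMap_orthogonal Y₁ (c := -1) (c' := 1) (by simp)
    have b2 := finrank_comap_graphMap_orthogonal Y₂ (c := -1) (c' := 1) (by simp)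
    rw [hk, zero_pow two_ne_zero, eigenMultiplicity_zero, eigenMultiplicity_zero, Nat.cast_inj]
    -- Write `A, B` for the dimensions of `Y` meeting the diagonal and antidiagonal, `A', B'` for
    -- those of `Yᗮ`. The spectrum gives `A`, `A + B'` and `B + A'`. Then `B' - A = |E| - dim Y` is
    -- known, and it equals `B - A'`; with `B + A'` this determines `A'`, the multiplicity sought.
    omega
  · obtain ⟨k', hk', hcos, hsin⟩ : ∃ k' : ℂ, k' ≠ 0 ∧ Complex.cos k' = -Complex.cos k ∧
        Complex.sin k' = Complex.sin k := by
      by_cases hkp : Real.pi - k = 0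
      -- For `k = π` the choice `π - k` would be `0`, where `sin k' / k'` is not available; a shift
      -- by a full period avoids this.
      · refine ⟨Real.pi - k + 2 * Real.pi, ?_, ?_, ?_⟩
        · rw [hkp, zero_add]
          exact mul_ne_zero two_ne_zero hpi
        · rw [Complex.cos_add_two_pi, Complex.cos_pi_sub]
        · rw [Complex.sin_add_two_pi, Complex.sin_pi_sub]
      · exact ⟨Real.pi - k, hkp, Complex.cos_pi_sub k, Complex.sin_pi_sub k⟩
    rw [eigenMultiplicity_orthogonal Y₁ hk hk' hcos hsin,
      eigenMultiplicity_orthogonal Y₂ hk hk' hcos hsin]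
    exact h _

end MetricGraph

end

theorem corollary5p2 {V₁ V₂ : Type*}
    [Fintype V₁] [DecidableEq V₁] [Fintype V₂] [DecidableEq V₂]
    (G₁ : SimpleGraph V₁) (G₂ : SimpleGraph V₂)
    [DecidableRel G₁.Adj] [DecidableRel G₂.Adj]
    (o₁ : MetricGraph.EdgeOrientation G₁) (o₂ : MetricGraph.EdgeOrientation G₂) :
    MetricGraph.Isospectral (-MetricGraph.laplacianCK o₁) (-MetricGraph.laplacianCK o₂) ↔
      MetricGraph.Isospectral (-MetricGraph.laplacianKC o₁) (-MetricGraph.laplacianKC o₂) := by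
  refine ⟨MetricGraph.Isospectral.orthogonal, fun h => ?_⟩
  have h' := MetricGraph.Isospectral.orthogonal h
  rwa [Submodule.orthogonal_orthogonal, Submodule.orthogonal_orthogonal] at h'
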